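/- All rings are associative with $1$ and a *field* means a possibly non-commutative division ring. A *crossed product* $RG$ of a ring $R$ by a group $G$ is an associative ring which is a free left $R$-module with basis $\{\bar x\mid x\in G\}$ and whose multiplication is determined by $\bar x\,r=\sigma(x)(r)\,\bar x$ and $\bar x\,\bar y=\tau(x,y)\,\overline{xy}$ for maps $\sigma\colon G\to \mathrm{Aut}(R)$ and $\tau\colon G\times G\to R^{\times}$, normalized so that $\bar 1=1$. An *ordered group* $(G,<)$ is a group with a total order such that $x<y$ implies $zx<zy$ and $xz<yz$. For such $G$ the *Malcev–Neumann series ring* $R((G,<))$ consists of the formal sums $\sum_{x\in G}a_x\bar x$ with $a_x\in R$ and well-ordered support, added componentwise and multiplied by $$\Big(\sum_y a_y\bar y\Big)\Big(\sum_z b_z\bar z\Big)=\sum_x\Big(\sum_{yz=x}a_y\,\sigma(y)(b_z)\,\tau(y,z)\Big)\bar x .$$ It is a field if $R$ is a field. Let $\iota\colon R\hookrightarrow E$ be an embedding of a domain $R$ into a field $E$. Put $E_\iota(-1)=\emptyset$, $E_\iota(0)=R$ and, for $n\ge 0$, let $E_\iota(n+1)$ be the subring of $E$ generated by $E_\iota(n)$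 and the inverses of the nonzero elements of $E_\iota(n)$. An element $f\in E$ has *inversion height* $\mathrm h_\iota(f)=n$ if $f\in E_\iota(n)\setminus E_\iota(n-1)$, where $n\geq 0$. The *inversion height* $\mathrm h_\iota(R)$ is the least $n\ge 0$ such that $E_\iota(n)$ is a field, and $\infty$ if there is no such $n$. The embedding $\iota$ is a *field of fractions* of $R$ if $E$ is generated as a field by $R$. **Theorem.** Let $S$ be a domain with a field of fractions $\varepsilon\colon S\hookrightarrow F$ and let $(G,<)$ be an ordered group. Consider a crossed product $SG$ that extends to a crossed product $FG$, i.e. $FG$ has automorphisms $\sigma'(x)$ extending the automorphisms $\sigma(x)$ of $SG$ and the same $\tau$. For every $n\ge 0$, the maps $\sigma'$ and $\tau$ then restrict to a crossed product $F_\varepsilon(n)G\subseteq FG$. Let $E=F((G,<))$ be the Malcev–Neumann series ring of $FG$, let $\iota\colon SG\hookrightarrow E$ be the natural embedding, and regard $F$ as a subring of $E$ via $a\mapsto a\bar 1$. Then: 1. $E_\iota(n)\subseteq F_\varepsilon(n)((G,<))$ for each integer $n\ge 0$. 2. Let $f\in F$ and let $n\ge 0$. If $\mathrm h_\varepsilon(f)=n$,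 then $\mathrm h_\iota(f)=n$. 3. $\mathrm h_\iota(SG)\ge \mathrm h_\varepsilon(S)$. -/

import Mathlib

noncomputable section

namespace InversionHeight

/-! ### Crossed products -/

/-- The data of a crossed product `RG` of the ring `R` by the group `G`: the action
`σ = act` and the twisting `τ = twist`, with `x̄ * r = σ(x)(r) * x̄` and `x̄ * ȳ = τ(x, y) * (xy)‾`.
The first two laws say exactly that the multiplication on the free left `R`-module with basis
`{x̄ | x ∈ G}` determined by these rules is associative; the last two are the usual normalization
`1̄ = 1`. -/
structure CrossedSystem (R G : Type*) [Ring R] [Group G] where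
  act : G → R ≃+* R
  twist : G → G → Rˣ
  act_act : ∀ x y r, act x (act y r) * twist x y = twist x y * act (x * y) r
  twist_assoc : ∀ x y z,
    (twist x y : R) * twist (x * y) z = act x (twist y z) * twist x (y * z)
  twist_one_left : ∀ x, twist 1 x = 1
  twist_one_right : ∀ x, twist x 1 = 1

namespace CrossedSystem

variable {R G : Type*} [Ring R] [Group G] (c : CrossedSystem R G)

theorem act_one (r : R) : c.act 1 r = r := by
  have h := c.act_act 1 1 r
  rw [c.twist_one_left] at h
  simp only [Units.val_one, mul_one, one_mul] at h
  exact (c.act 1).injective h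

/-- `(a x̄)((b ȳ)(d z̄)) = ((a x̄)(b ȳ))(d z̄)`, on coefficients. -/
theorem coeff_assoc (x y z : G) (a b d : R) :
    (a * c.act x b * c.twist x y) * c.act (x * y) d * c.twist (x * y) z =
      a * c.act x (b * c.act y d * c.twist y z) * c.twist x (y * z) := by
  simp only [map_mul, mul_assoc]
  rw [← c.twist_assoc x y z, ← mul_assoc (c.act x (c.act y d)), c.act_act]
  simp only [mul_assoc]

end CrossedSystem

/-- The crossed product `RG`: finite formal sums `∑ a_x x̄`. -/
def CrossedProduct {R G : Type*} [Ring R] [Group G] (_c : CrossedSystem R G) := G →₀ R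

namespace CrossedProduct

variable {R G : Type*} [Ring R] [Group G] {c : CrossedSystem R G}

instance : AddCommGroup (CrossedProduct c) := inferInstanceAs (AddCommGroup (G →₀ R))

/-- The element `a x̄`. -/
def single (c : CrossedSystem R G) (x : G) : R →+ CrossedProduct c := Finsupp.singleAddHom x

/-- The coefficients `a_x` of `∑ a_x x̄`. -/
def coeff (f : CrossedProduct c) : G →₀ R := f

theorem induction {p : CrossedProduct c → Prop} (h0 : p 0)
    (hadd : ∀ f g, p f → p g → p (f + g)) (hs : ∀ x a, p (single c x a)) (f : CrossedProduct c) :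
    p f :=
  Finsupp.induction_linear (motive := p) f h0 hadd hs

/-- `(∑ a_y ȳ)(∑ b_z z̄) = ∑ a_y σ(y)(b_z) τ(y, z) (yz)‾`. -/
instance : Mul (CrossedProduct c) where
  mul f g := f.coeff.sum fun y a => g.coeff.sum fun z b =>
    single c (y * z) (a * c.act y b * c.twist y z)

instance : One (CrossedProduct c) where
  one := single c 1 1

theorem mul_def (f g : CrossedProduct c) :
    f * g = f.coeff.sum fun y a => g.coeff.sum fun z b =>
      single c (y * z) (a * c.act y b * c.twist y z) := rfl

theorem one_def : (1 : CrossedProduct c) = single c 1 1 := rfl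

theorem coeff_add (f g : CrossedProduct c) : (f + g).coeff = f.coeff + g.coeff := rfl

theorem coeff_single (x : G) (a : R) : (single c x a).coeff = Finsupp.single x a := rfl

protected theorem mul_add (f g h : CrossedProduct c) : f * (g + h) = f * g + f * h := by
  simp only [mul_def, coeff_add]
  rw [← Finsupp.sum_add]
  refine Finsupp.sum_congr fun y _ => ?_
  exact Finsupp.sum_add_index' (by simp) (by simp [mul_add, add_mul])

protected theorem add_mul (f g h : CrossedProduct c) : (f + g) * h = f * h + g * h := by
  simp only [mul_def, coeff_add]
  refine Finsupp.sum_add_index' (fun y => ?_) fun y a b => ?_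
  · simp
  · rw [← Finsupp.sum_add]
    simp [add_mul]

protected theorem zero_mul (f : CrossedProduct c) : 0 * f = 0 := by
  have h := CrossedProduct.add_mul 0 0 f
  rw [add_zero] at h
  exact left_eq_add.mp h

protected theorem mul_zero (f : CrossedProduct c) : f * 0 = 0 := by
  have h := CrossedProduct.mul_add f 0 0
  rw [add_zero] at h
  exact left_eq_add.mp h

theorem single_mul_single (y z : G) (a b : R) :
    single c y a * single c z b = single c (y * z) (a * c.act y b * c.twist y z) := by
  simp only [mul_def, coeff_single]
  rw [Finsupp.sum_single_index, Finsupp.sum_single_index] <;> simp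

instance : Ring (CrossedProduct c) where
  left_distrib := CrossedProduct.mul_add
  right_distrib := CrossedProduct.add_mul
  zero_mul := CrossedProduct.zero_mul
  mul_zero := CrossedProduct.mul_zero
  mul_assoc f g h := by
    induction f using induction with
    | h0 => simp only [CrossedProduct.zero_mul]
    | hadd f f' h1 h2 => simp only [CrossedProduct.add_mul, h1, h2]
    | hs x a =>
      induction g using induction with
      | h0 => simp only [CrossedProduct.zero_mul, CrossedProduct.mul_zero]
      | hadd f f' h1 h2 => simp only [CrossedProduct.add_mul, CrossedProduct.mul_add, h1, h2]
      | hs y b =>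
        induction h using induction with
        | h0 => simp only [CrossedProduct.mul_zero]
        | hadd f f' h1 h2 => simp only [CrossedProduct.mul_add, h1, h2]
        | hs z d =>
          simp only [single_mul_single]
          rw [c.coeff_assoc, mul_assoc]
  one_mul f := by
    induction f using induction with
    | h0 => exact CrossedProduct.mul_zero 1
    | hadd f f' h1 h2 => rw [CrossedProduct.mul_add, h1, h2]
    | hs x a =>
      rw [one_def, single_mul_single, c.act_one, c.twist_one_left]
      simp
  mul_one f := by
    induction f using induction with
    | h0 => exact CrossedProduct.zero_mul 1
    | hadd f f' h1 h2 => rw [CrossedProduct.add_mul, h1, h2]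
    | hs x a =>
      rw [one_def, single_mul_single, c.twist_one_right]
      simp
  zsmul := zsmulRec
  neg_add_cancel f := neg_add_cancel f
  sub_eq_add_neg f g := sub_eq_add_neg f g

end CrossedProduct

/-! ### Malcev–Neumann series -/

/-- The Malcev–Neumann series `R((G, <))` attached to a crossed product `RG`: formal sums
`∑ a_x x̄` with well-ordered support. The order on `G` being total, well-ordered is the same as
partially well-ordered (`Set.isPWO_iff_isWF`). -/
def Series {R G : Type*} [Ring R] [Group G] [LinearOrder G] (_c : CrossedSystem R G) :=
  HahnSeries G R

namespace Series

section Additive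

variable {R G : Type*} [Ring R] [Group G] [LinearOrder G] {c : CrossedSystem R G}

instance : AddCommGroup (Series c) := inferInstanceAs (AddCommGroup (HahnSeries G R))

/-- The coefficient of `x̄`. -/
def coeff (f : Series c) (x : G) : R := HahnSeries.coeff f x

/-- The support of a series. -/
def supp (f : Series c) : Set G := {x | f.coeff x ≠ 0}

theorem isPWO_supp (f : Series c) : f.supp.IsPWO := HahnSeries.isPWO_support' f

/-- The series with given coefficients. -/
def mk (c : CrossedSystem R G) (f : G → R) (hf : {x | f x ≠ 0}.IsPWO) : Series c :=
  HahnSeries.mk f hf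

@[simp] theorem coeff_mk (f : G → R) (hf : {x | f x ≠ 0}.IsPWO) (x : G) :
    (mk c f hf).coeff x = f x := rfl

@[ext] theorem ext {f g : Series c} (h : ∀ x, f.coeff x = g.coeff x) : f = g :=
  HahnSeries.ext (funext h)

@[simp] theorem coeff_add (f g : Series c) (x : G) : (f + g).coeff x = f.coeff x + g.coeff x := rfl

@[simp] theorem coeff_zero (x : G) : (0 : Series c).coeff x = 0 := rfl

@[simp] theorem coeff_neg (f : Series c) (x : G) : (-f).coeff x = -f.coeff x := rfl

@[simp] theorem coeff_sub (f g : Series c) (x : G) : (f - g).coeff x = f.coeff x - g.coeff x := rfl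

/-- The element `a x̄`. -/
def single (c : CrossedSystem R G) (x : G) (a : R) : Series c := HahnSeries.single x a

theorem coeff_single (x y : G) (a : R) :
    (single c x a).coeff y = if y = x then a else 0 := by
  classical
  exact HahnSeries.coeff_single.trans (by congr)

instance : One (Series c) where
  one := single c 1 1

theorem one_def : (1 : Series c) = single c 1 1 := rfl

/-- The summand `a_y σ(y)(b_z) τ(y, z)`, where `z = y⁻¹x`, of the coefficient of `x̄` in the product
of `∑ a_y ȳ` and `∑ b_z z̄`. -/
def mulTerm (f g : Series c) (x y : G) : R :=
  f.coeff y * c.act y (g.coeff (y⁻¹ * x)) * c.twist y (y⁻¹ * x)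

theorem mulTerm_ne {f g : Series c} {x y : G} (h : mulTerm f g x y ≠ 0) :
    y ∈ f.supp ∧ y⁻¹ * x ∈ g.supp := by
  constructor
  · intro h0
    exact h (by simp [mulTerm, h0])
  · intro h0
    exact h (by simp [mulTerm, h0])

theorem exists_ne_of_finsum {R ι : Type*} [Ring R] {φ : ι → R} (h : (∑ᶠ i, φ i) ≠ 0) : ∃ i, φ i ≠ 0 := by
  by_contra! h0
  exact h (by simp [h0])

end Additive

section Ordered

variable {R G : Type*} [Ring R] [Group G] [LinearOrder G] [MulLeftMono G]
  [MulRightMono G] {c : CrossedSystem R G}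

theorem isPWO_mul {s t : Set G} (hs : s.IsPWO) (ht : t.IsPWO) :
    {x | ∃ y ∈ s, ∃ z ∈ t, y * z = x}.IsPWO := by
  have h := (hs.prod ht).image_of_monotone (f := fun p : G × G => p.1 * p.2)
    fun p q hpq => mul_le_mul' hpq.1 hpq.2
  refine h.mono ?_
  rintro _ ⟨y, hy, z, hz, rfl⟩
  exact ⟨(y, z), ⟨hy, hz⟩, rfl⟩

theorem finite_fiber {s t : Set G} (hs : s.IsPWO) (ht : t.IsPWO) (x : G) :
    {y | y ∈ s ∧ y⁻¹ * x ∈ t}.Finite := by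
  by_contra h
  have h : {y | y ∈ s ∧ y⁻¹ * x ∈ t}.Infinite := h
  obtain ⟨g, hg⟩ := (hs.mono fun y (hy : y ∈ s ∧ y⁻¹ * x ∈ t) => hy.1).exists_monotone_subseq
    fun n => (h.natEmbedding _ n).2
  obtain ⟨m, n, hmn, hle⟩ := ht.exists_lt (fun n => (h.natEmbedding _ (g n)).2.2)
  have h1 : (h.natEmbedding _ (g m) : G) ≤ h.natEmbedding _ (g n) := hg hmn.le
  have h2 : (h.natEmbedding _ (g n) : G) ≤ h.natEmbedding _ (g m) :=
    inv_le_inv_iff.mp (le_of_mul_le_mul_right' hle)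
  exact hmn.ne (g.injective ((h.natEmbedding _).injective (Subtype.ext (le_antisymm h1 h2))))

theorem mulTerm_finite (f g : Series c) (x : G) : (mulTerm f g x).HasFiniteSupport :=
  (finite_fiber f.isPWO_supp g.isPWO_supp x).subset fun _ hy => mulTerm_ne hy

theorem mul_isPWO (f g : Series c) : {x | (∑ᶠ y, mulTerm f g x y) ≠ 0}.IsPWO := by
  refine (isPWO_mul f.isPWO_supp g.isPWO_supp).mono fun x hx => ?_
  obtain ⟨y, hy⟩ := exists_ne_of_finsum hx
  obtain ⟨h1, h2⟩ := mulTerm_ne hy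
  exact ⟨y, h1, _, h2, by simp⟩

/-- The coefficient of `x̄` in `(∑ a_y ȳ)(∑ b_z z̄)` is `∑_{yz = x} a_y σ(y)(b_z) τ(y, z)`
(a finite sum). -/
instance : Mul (Series c) where
  mul f g := mk c (fun x => ∑ᶠ y, mulTerm f g x y) (mul_isPWO f g)

theorem coeff_mul (f g : Series c) (x : G) : (f * g).coeff x = ∑ᶠ y, mulTerm f g x y := rfl

theorem mem_supp_mul {f g : Series c} {x : G} (hx : x ∈ (f * g).supp) :
    ∃ y ∈ f.supp, ∃ z ∈ g.supp, y * z = x := by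
  obtain ⟨y, hy⟩ := exists_ne_of_finsum hx
  obtain ⟨h1, h2⟩ := mulTerm_ne hy
  exact ⟨y, h1, _, h2, by simp⟩

theorem coeff_single_mul (y : G) (a : R) (g : Series c) (x : G) :
    (single c y a * g).coeff x = a * c.act y (g.coeff (y⁻¹ * x)) * c.twist y (y⁻¹ * x) := by
  rw [coeff_mul, finsum_eq_single _ y]
  · simp [mulTerm, coeff_single]
  · intro z hz
    simp [mulTerm, coeff_single, hz]

theorem single_mul_single (y z : G) (a b : R) :
    single c y a * single c z b = single c (y * z) (a * c.act y b * c.twist y z) := by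
  ext x
  rw [coeff_single_mul, coeff_single, coeff_single]
  by_cases h : x = y * z
  · subst h
    simp
  · have h' : y⁻¹ * x ≠ z := fun h' => h (by simp [← h'])
    simp [h, h']

protected theorem mul_add (f g h : Series c) : f * (g + h) = f * g + f * h := by
  ext x
  rw [coeff_add, coeff_mul, coeff_mul, coeff_mul,
    ← finsum_add_distrib (mulTerm_finite f g x) (mulTerm_finite f h x)]
  exact finsum_congr fun y => by simp [mulTerm, mul_add, add_mul]

protected theorem add_mul (f g h : Series c) : (f + g) * h = f * h + g * h := by
  ext x
  rw [coeff_add, coeff_mul, coeff_mul, coeff_mul,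
    ← finsum_add_distrib (mulTerm_finite f h x) (mulTerm_finite g h x)]
  exact finsum_congr fun y => by simp [mulTerm, add_mul]

protected theorem mul_assoc (f g h : Series c) : f * g * h = f * (g * h) := by
  ext x
  -- the summand indexed by `(y, z)`, with third index `z⁻¹y⁻¹x`
  let T : G × G → R := fun p => f.coeff p.1 *
    c.act p.1 (g.coeff p.2 * c.act p.2 (h.coeff (p.2⁻¹ * (p.1⁻¹ * x))) *
      c.twist p.2 (p.2⁻¹ * (p.1⁻¹ * x))) * c.twist p.1 (p.1⁻¹ * x)
  have hT : T.HasFiniteSupport := by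
    have hfin : {y | y ∈ f.supp ∧ y⁻¹ * x ∈ {w | ∃ z ∈ g.supp, ∃ v ∈ h.supp, z * v = w}}.Finite :=
      finite_fiber f.isPWO_supp (isPWO_mul g.isPWO_supp h.isPWO_supp) x
    refine Set.Finite.subset (hfin.biUnion fun y _ =>
      (finite_fiber g.isPWO_supp h.isPWO_supp (y⁻¹ * x)).image (Prod.mk y)) ?_
    rintro ⟨y, z⟩ hp
    have h1 : y ∈ f.supp := fun h0 => hp (by simp [T, h0])
    have h2 : z ∈ g.supp := fun h0 => hp (by simp [T, h0])
    have h3 : z⁻¹ * (y⁻¹ * x) ∈ h.supp := fun h0 => hp (by simp [T, h0])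
    simp only [Set.mem_iUnion]
    exact ⟨y, ⟨h1, z, h2, _, h3, by simp⟩, z, ⟨h2, h3⟩, rfl⟩
  have hr : (f * (g * h)).coeff x = ∑ᶠ p, T p := by
    rw [finsum_curry T hT, coeff_mul]
    refine finsum_congr fun y => ?_
    rw [mulTerm, coeff_mul, map_finsum (c.act y) (mulTerm_finite g h _), mul_finsum', finsum_mul']
    · rfl
    · refine (mulTerm_finite g h (y⁻¹ * x)).subset fun z hz h0 => hz ?_
      simp [h0]
    · refine (mulTerm_finite g h (y⁻¹ * x)).subset fun z hz h0 => hz ?_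
      simp [h0]
  let e : G × G ≃ G × G :=
    { toFun := fun p => (p.2, p.2⁻¹ * p.1)
      invFun := fun p => (p.1 * p.2, p.1)
      left_inv := fun p => by simp
      right_inv := fun p => by simp }
  have hl : (f * g * h).coeff x = ∑ᶠ p, T (e p) := by
    rw [finsum_curry (fun p => T (e p)) (hT.preimage e.injective.injOn), coeff_mul]
    refine finsum_congr fun u => ?_
    rw [mulTerm, coeff_mul, finsum_mul' _ _ (mulTerm_finite f g u), finsum_mul']
    · refine finsum_congr fun y => ?_
      have := c.coeff_assoc y (y⁻¹ * u) (u⁻¹ * x) (f.coeff y) (g.coeff (y⁻¹ * u))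
        (h.coeff (u⁻¹ * x))
      simp only [mul_inv_cancel_left] at this
      simp only [mulTerm, T, e, Equiv.coe_fn_mk, this]
      simp [mul_assoc]
    · refine (mulTerm_finite f g u).subset fun z hz h0 => hz ?_
      simp [h0]
  rw [hl, hr]
  exact finsum_comp_equiv e

instance : Ring (Series c) where
  left_distrib := Series.mul_add
  right_distrib := Series.add_mul
  zero_mul f := by
    have h := Series.add_mul 0 0 f
    rw [add_zero] at h
    exact left_eq_add.mp h
  mul_zero f := by
    have h := Series.mul_add f 0 0
    rw [add_zero] at h
    exact left_eq_add.mp h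
  mul_assoc := Series.mul_assoc
  one_mul f := by
    ext x
    rw [one_def, coeff_single_mul]
    simp [c.act_one, c.twist_one_left]
  mul_one f := by
    ext x
    rw [coeff_mul, finsum_eq_single _ x]
    · simp [mulTerm, one_def, coeff_single, c.twist_one_right]
    · intro y hy
      have : y⁻¹ * x ≠ 1 := fun h0 => hy (inv_mul_eq_one.mp h0)
      simp [mulTerm, one_def, coeff_single, this]
  zsmul := zsmulRec
  neg_add_cancel f := neg_add_cancel f
  sub_eq_add_neg f g := sub_eq_add_neg f g

/-- The embedding of the coefficient ring `R` into `R((G, <))`, `a ↦ a 1̄`. -/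
def C (c : CrossedSystem R G) : R →+* Series c where
  toFun a := single c 1 a
  map_one' := rfl
  map_zero' := by ext; simp [coeff_single]
  map_add' a b := by
    ext x
    by_cases h : x = 1 <;> simp [coeff_single, h]
  map_mul' a b := by
    rw [single_mul_single, c.act_one, c.twist_one_left]
    simp

/-- The natural embedding of the crossed product `RG` into `R((G, <))`: a finite sum `∑ a_x x̄`
is sent to itself. -/
def ofCrossedProduct (c : CrossedSystem R G) : CrossedProduct c →+* Series c :=
  let φ : CrossedProduct c →+ Series c :=
    { toFun := fun f => mk c f.coeff f.coeff.hasFiniteSupport.isPWO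
      map_zero' := rfl
      map_add' := fun _ _ => rfl }
  have hφ : ∀ x a, φ (CrossedProduct.single c x a) = single c x a := fun x a => by
    ext y
    rw [coeff_single]
    exact (Finsupp.single_apply (a := x) (a' := y) (b := a)).trans (by simp [eq_comm])
  { φ with
    map_one' := hφ 1 1
    map_mul' := fun f g => by
      change φ (f * g) = φ f * φ g
      induction f using CrossedProduct.induction with
      | h0 => simp
      | hadd f f' h1 h2 => simp only [add_mul, map_add, h1, h2]
      | hs x a =>
        induction g using CrossedProduct.induction with
        | h0 => simp
        | hadd f f' h1 h2 => simp only [mul_add, map_add, h1, h2]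
        | hs y b => rw [CrossedProduct.single_mul_single, hφ, hφ, hφ, single_mul_single] }

end Ordered

/-! ### Series over a field form a field -/

section Field

variable {F G : Type*} [DivisionRing F] [Group G] [LinearOrder G] [MulLeftMono G]
  [MulRightMono G] {c : CrossedSystem F G}

/-- If all exponents of `g` are `> 1`, then `1 - g` has a right inverse. -/
theorem exists_eq_one_add_mul (g : Series c) (hg : ∀ x ∈ g.supp, 1 < x) :
    ∃ h : Series c, h = 1 + g * h := by
  classical
  let T : Set G := List.prod '' {l : List G | ∀ x, x ∈ l → x ∈ g.supp}
  have hT : T.IsPWO := by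
    have := (g.isPWO_supp).partiallyWellOrderedOn_sublistForall₂ (· ≤ ·)
    refine Set.PartiallyWellOrderedOn.image_of_monotone_on this ?_
    exact fun l1 _ l2 hl2 h12 => h12.prod_le_prod' fun x hx => (hg x (hl2 x hx)).le
  have h1T : (1 : G) ∈ T := ⟨[], by simp, rfl⟩
  have hmT : ∀ x y, y ∈ g.supp → y⁻¹ * x ∈ T → x ∈ T := by
    rintro x y hy ⟨l, hl, hlx⟩
    refine ⟨y :: l, ?_, ?_⟩
    · intro z hz
      rcases List.mem_cons.mp hz with rfl | hz
      · exact hy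
      · exact hl z hz
    · rw [List.prod_cons, hlx, mul_inv_cancel_left]
  have hlt : ∀ x y, y ∈ g.supp → y⁻¹ * x < x := fun x y hy =>
    mul_lt_of_lt_one_left' x (inv_lt_one'.mpr (hg y hy))
  have wf : WellFounded fun a b : T => (a : G) < b := hT.isWF
  let φ : T → F := wf.fix fun x ih => (if (x : G) = 1 then 1 else 0) +
    ∑ᶠ y : G, if hy : y ∈ g.supp ∧ y⁻¹ * (x : G) ∈ T then
      g.coeff y * c.act y (ih ⟨y⁻¹ * x, hy.2⟩ (hlt x y hy.1)) * c.twist y (y⁻¹ * x) else 0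
  have hφ : ∀ x : T, φ x = (if (x : G) = 1 then 1 else 0) +
    ∑ᶠ y : G, if hy : y ∈ g.supp ∧ y⁻¹ * (x : G) ∈ T then
      g.coeff y * c.act y (φ ⟨y⁻¹ * x, hy.2⟩) * c.twist y (y⁻¹ * x) else 0 :=
    fun x => wf.fix_eq _ x
  let k : G → F := fun x => if hx : x ∈ T then φ ⟨x, hx⟩ else 0
  have hk : {x | k x ≠ 0}.IsPWO := hT.mono fun x hx => by
    by_contra h
    exact hx (by simp [k, h])
  refine ⟨mk c k hk, ?_⟩
  ext x
  rw [coeff_add, coeff_mul, one_def, coeff_single, coeff_mk]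
  by_cases hx : x ∈ T
  · have hkx : k x = φ ⟨x, hx⟩ := by simp [k, hx]
    rw [hkx, hφ]
    congr 1
    refine finsum_congr fun y => ?_
    by_cases hy : y ∈ g.supp ∧ y⁻¹ * x ∈ T
    · simp [mulTerm, k, hy]
    · rw [dif_neg hy]
      by_contra h
      obtain ⟨h1, h2⟩ := mulTerm_ne (Ne.symm h)
      refine hy ⟨h1, ?_⟩
      by_contra h3
      exact h2 (by simp [k, h3])
  · have hkx : k x = 0 := by simp [k, hx]
    have hx1 : x ≠ 1 := fun h => hx (h ▸ h1T)
    rw [hkx, if_neg hx1, zero_add]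
    refine (finsum_eq_zero_of_forall_eq_zero fun y => ?_).symm
    by_contra h
    obtain ⟨h1, h2⟩ := mulTerm_ne h
    refine hx (hmT x y h1 ?_)
    by_contra h3
    exact h2 (by simp [k, h3])

theorem exists_mul_eq_one (f : Series c) (hf : f ≠ 0) : ∃ r, f * r = 1 := by
  have hne : f.supp.Nonempty := by
    by_contra h
    rw [Set.not_nonempty_iff_eq_empty] at h
    refine hf (ext fun x => ?_)
    by_contra hx
    have : x ∈ f.supp := hx
    simp [h] at this
  obtain ⟨x₀, hx₀, hmin⟩ : ∃ x₀ ∈ f.supp, ∀ x ∈ f.supp, x₀ ≤ x :=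
    ⟨_, f.isPWO_supp.isWF.min_mem hne, fun x hx => f.isPWO_supp.isWF.min_le hne hx⟩
  let u : Series c := single c x₀⁻¹
    ((c.act x₀).symm ((f.coeff x₀)⁻¹ * ((c.twist x₀ x₀⁻¹)⁻¹ : Fˣ)))
  have hu : ∀ z ∈ u.supp, z = x₀⁻¹ := fun z hz => by
    by_contra h
    exact hz (by simp [u, coeff_single, h])
  have hone : (f * u).coeff 1 = 1 := by
    rw [coeff_mul, finsum_eq_single _ x₀]
    · have h0 : f.coeff x₀ ≠ 0 := hx₀
      simp only [mulTerm, u, coeff_single, mul_one, if_true, RingEquiv.apply_symm_apply]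
      rw [← mul_assoc, mul_inv_cancel₀ h0, one_mul, Units.inv_mul]
    · intro y hy
      by_contra h
      have := hu _ (mulTerm_ne h).2
      rw [mul_one] at this
      exact hy (inv_injective this)
  obtain ⟨h, hh⟩ := exists_eq_one_add_mul (1 - f * u) (by
    intro x hx
    have hx1 : x ≠ 1 := by
      rintro rfl
      exact hx (by rw [coeff_sub, hone, one_def, coeff_single, if_pos rfl, sub_self])
    have hx2 : x ∈ (f * u).supp := fun h0 => hx (by
      rw [coeff_sub, h0, one_def, coeff_single, if_neg hx1, sub_self])
    obtain ⟨y, hy, z, hz, rfl⟩ := mem_supp_mul hx2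
    rw [hu z hz] at hx1 ⊢
    exact lt_of_le_of_ne (le_mul_inv_iff_mul_le.mpr (by rw [one_mul]; exact hmin y hy)) hx1.symm)
  refine ⟨u * h, ?_⟩
  rw [sub_mul, one_mul] at hh
  rw [← mul_assoc]
  have h2 : h + f * u * h = h + 1 := by
    nth_rewrite 1 [hh]
    abel
  exact add_left_cancel h2

instance : Nontrivial (Series c) := ⟨0, 1, fun h => by
  have := congrArg (fun f => coeff f 1) h
  simp [one_def, coeff_single] at this⟩

theorem isUnit_or_eq_zero (f : Series c) : IsUnit f ∨ f = 0 := by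
  by_cases hf : f = 0
  · exact Or.inr hf
  left
  obtain ⟨r, hr⟩ := exists_mul_eq_one f hf
  have hr0 : r ≠ 0 := by
    rintro rfl
    rw [mul_zero] at hr
    exact zero_ne_one hr
  obtain ⟨s, hs⟩ := exists_mul_eq_one r hr0
  have hfs : f = s := by
    rw [← mul_one f, ← hs, ← mul_assoc, hr, one_mul]
  rw [← hfs] at hs
  exact ⟨⟨f, r, hr, hs⟩, rfl⟩

/-- The theorem of Malcev and Neumann: `F((G, <))` is a field. -/
instance : DivisionRing (Series c) := DivisionRing.ofIsUnitOrEqZero isUnit_or_eq_zero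

end Field

end Series

/-! ### Extensions of crossed products -/

/-- For `ε : R → R'`, the crossed product `R'G` of `c'` extends the crossed product `RG` of `c`:
the map `∑ a_x x̄ ↦ ∑ ε(a_x) x̄` respects the twistings and the actions. -/
structure IsExtension {R R' G : Type*} [Ring R] [Ring R'] [Group G] (ε : R →+* R')
    (c : CrossedSystem R G) (c' : CrossedSystem R' G) : Prop where
  act : ∀ x r, c'.act x (ε r) = ε (c.act x r)
  twist : ∀ x y, (c'.twist x y : R') = ε (c.twist x y)

namespace IsExtension

variable {R R' G : Type*} [Ring R] [Ring R'] [Group G] [LinearOrder G] [MulLeftMono G]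
  [MulRightMono G] {ε : R →+* R'} {c : CrossedSystem R G} {c' : CrossedSystem R' G}

/-- The natural map `R((G, <)) → R'((G, <))`, `∑ a_x x̄ ↦ ∑ ε(a_x) x̄`. -/
def seriesMap (h : IsExtension ε c c') : Series c →+* Series c' where
  toFun f := Series.mk c' (fun x => ε (f.coeff x))
    (f.isPWO_supp.mono fun x hx h0 => hx (by rw [h0, map_zero]))
  map_zero' := Series.ext fun x => map_zero ε
  map_add' f g := Series.ext fun x => map_add ε _ _
  map_one' := Series.ext fun x => by
    rw [Series.coeff_mk, Series.one_def, Series.one_def, Series.coeff_single, Series.coeff_single]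
    split <;> simp
  map_mul' f g := Series.ext fun x => by
    rw [Series.coeff_mk, Series.coeff_mul, Series.coeff_mul,
      map_finsum ε (Series.mulTerm_finite f g x)]
    exact finsum_congr fun y => by simp [Series.mulTerm, h.act, h.twist]

end IsExtension

/-! ### Inversion height -/

section Height

variable {R E : Type*} [Ring R] [DivisionRing E]

/-- `ε : R → E` is a field of fractions of `R`: it is injective and `E` is generated as a field by
the image of `R`. -/
structure IsFieldOfFractions (ε : R →+* E) : Prop where
  injective : Function.Injective ε
  closure_range : Subfield.closure (Set.range ε) = ⊤

/-- `E_ι(0) = R`, and `E_ι(n + 1)` is the subring of `E` generated by `E_ι(n)` and the inverses of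
its nonzero elements. -/
def stage (ι : R →+* E) : ℕ → Subring E
  | 0 => ι.range
  | n + 1 => Subring.closure ({r | r ∈ stage ι n} ∪ {t | ∃ s ∈ stage ι n, s ≠ 0 ∧ t = s⁻¹})

/-- `f` has inversion height `n`: `f ∈ E_ι(n) \ E_ι(n - 1)`, where `E_ι(-1) = ∅`. -/
def HasHeight (ι : R →+* E) (f : E) : ℕ → Prop
  | 0 => f ∈ stage ι 0
  | n + 1 => f ∈ stage ι (n + 1) ∧ f ∉ stage ι n

/-- The inversion height of `R` inside `E`: the least `n` such that the ring `E_ι(n)` is a field,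
`⊤` if there is none. -/
def height (ι : R →+* E) : ℕ∞ :=
  sInf {m | ∃ n : ℕ, m = n ∧ ∀ s ∈ stage ι n, s ≠ 0 → s⁻¹ ∈ stage ι n}

theorem range_le_stage (ι : R →+* E) (n : ℕ) : ι.range ≤ stage ι n := by
  induction n with
  | zero => exact le_rfl
  | succ n ih => exact fun r hr => Subring.subset_closure (Or.inl (ih hr))

theorem map_mem_stage (ι : R →+* E) (φ : E →+* E) (hφ : ∀ r, φ (ι r) ∈ ι.range) (n : ℕ)
    {a : E} (ha : a ∈ stage ι n) : φ a ∈ stage ι n := by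
  induction n generalizing a with
  | zero =>
    obtain ⟨r, rfl⟩ := ha
    exact hφ r
  | succ n ih =>
    have hle : stage ι (n + 1) ≤ (stage ι (n + 1)).comap φ := by
      refine Subring.closure_le.mpr ?_
      rintro t (ht | ⟨s, hs, hs0, rfl⟩)
      · exact Subring.subset_closure (Or.inl (ih ht))
      · exact Subring.subset_closure
          (Or.inr ⟨φ s, ih hs, (map_ne_zero φ).mpr hs0, map_inv₀ φ s⟩)
    exact hle ha

end Height

/-! ### The crossed products `F_ε(n)G` -/

/-- The restriction of a crossed product `RG` to a subring `A` of `R` that is stable under the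
action and its inverse and contains the twisting and its inverse. -/
def CrossedSystem.restrict {R G : Type*} [Ring R] [Group G] (d : CrossedSystem R G)
    (A : Subring R) (hact : ∀ x, ∀ a ∈ A, d.act x a ∈ A)
    (hsymm : ∀ x, ∀ a ∈ A, (d.act x).symm a ∈ A)
    (htwist : ∀ x y, (d.twist x y : R) ∈ A)
    (hinv : ∀ x y, (((d.twist x y)⁻¹ : Rˣ) : R) ∈ A) : CrossedSystem A G where
  act x :=
    { toFun := fun a => ⟨d.act x a, hact x a a.2⟩
      invFun := fun a => ⟨(d.act x).symm a, hsymm x a a.2⟩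
      left_inv := fun a => Subtype.ext ((d.act x).symm_apply_apply a)
      right_inv := fun a => Subtype.ext ((d.act x).apply_symm_apply a)
      map_mul' := fun a b => Subtype.ext (map_mul (d.act x) (a : R) b)
      map_add' := fun a b => Subtype.ext (map_add (d.act x) (a : R) b) }
  twist x y := ⟨⟨d.twist x y, htwist x y⟩, ⟨_, hinv x y⟩, Subtype.ext (Units.mul_inv _),
    Subtype.ext (Units.inv_mul _)⟩
  act_act x y r := Subtype.ext (d.act_act x y r)
  twist_assoc x y z := Subtype.ext (d.twist_assoc x y z)
  twist_one_left x := Units.ext (Subtype.ext (congrArg Units.val (d.twist_one_left x)))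
  twist_one_right x := Units.ext (Subtype.ext (congrArg Units.val (d.twist_one_right x)))

namespace IsExtension

variable {S F G : Type*} [Ring S] [DivisionRing F] [Group G] {ε : S →+* F}
  {c : CrossedSystem S G} {d : CrossedSystem F G}

/-- If `FG` extends `SG`, the crossed product `F_ε(n)G` inside `FG`. -/
def stageSystem (h : IsExtension ε c d) (n : ℕ) : CrossedSystem (stage ε n) G :=
  d.restrict (stage ε n)
    (fun x _ ha => map_mem_stage ε (d.act x : F →+* F)
      (fun r => ⟨c.act x r, (h.act x r).symm⟩) n ha)
    (fun x _ ha => map_mem_stage ε ((d.act x).symm : F →+* F)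
      (fun r => ⟨(c.act x).symm r, by
        have := h.act x ((c.act x).symm r)
        rw [RingEquiv.apply_symm_apply] at this
        exact ((d.act x).symm_apply_eq.mpr this.symm).symm⟩) n ha)
    (fun x y => range_le_stage ε n ⟨c.twist x y, (h.twist x y).symm⟩)
    (fun x y => range_le_stage ε n ⟨((c.twist x y)⁻¹ : Sˣ), by
      have : d.twist x y = Units.map (ε : S →* F) (c.twist x y) := Units.ext (h.twist x y)
      rw [this]
      rfl⟩)

theorem stageSystem_isExtension (h : IsExtension ε c d) (n : ℕ) :
    IsExtension (stage ε n).subtype (h.stageSystem n) d where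
  act _ _ := rfl
  twist _ _ := rfl

variable [LinearOrder G] [MulLeftMono G] [MulRightMono G]

/-- The natural embedding `SG → F((G, <))`, when `FG` extends `SG`. -/
def embedding (h : IsExtension ε c d) : CrossedProduct c →+* Series d :=
  h.seriesMap.comp (Series.ofCrossedProduct c)

theorem embedding_injective (h : IsExtension ε c d) (hε : Function.Injective ε) :
    Function.Injective h.embedding := fun f g hfg =>
  Finsupp.ext (f := f.coeff) (g := g.coeff) fun x => hε (congrArg (fun k => Series.coeff k x) hfg)

/-- The subring `F_ε(n)((G, <))` of `F((G, <))`. -/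
def stageSeries (h : IsExtension ε c d) (n : ℕ) : Subring (Series d) :=
  (h.stageSystem_isExtension n).seriesMap.range

end IsExtension

end InversionHeight

end

/-!
Everything follows from tracking coefficients: a series lies in `F_ε(n)((G, <))` exactly when all
of its coefficients lie in `F_ε(n)` (`mem_stageSeries_iff`).

The main point (`Series.coeff_inv_mem`) is that inverting a series needs only one inversion of a
coefficient. Let `A` be a subring of `F` stable under the crossed product structure, let `f ≠ 0`
have coefficients in `A`, and suppose that the inverse of the lowest coefficient of `f` lies in `A`.
If `x₀` is the least element of the support of `f`, then comparing the coefficients of `x₀x` in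
`f f⁻¹ = 1` expresses the coefficient of `f⁻¹` at `x` through the inverse of the lowest coefficient
of `f` and coefficients of `f⁻¹` at elements `< x`; since the support of `f⁻¹` is well-ordered, all
coefficients of `f⁻¹` lie in `A`. With `A = F_ε(n + 1)` this is the induction step for
`E_ι(n) ⊆ F_ε(n)((G, <))`.

Conversely `a ↦ a 1̄` maps `F_ε(n)` into `E_ι(n)` (`C_mem_stage`). As the coefficient at `1` of
`a 1̄` is `a`, the two inclusions give `a 1̄ ∈ E_ι(n) ↔ a ∈ F_ε(n)`, from which the statements on
inversion heights follow.
-/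

namespace InversionHeight

/-- A ring homomorphism between fields that carries `R` into `R'` carries every stage over `R` into
the corresponding stage over `R'`. -/
theorem map_mem_stage_of_range {R R' E E' : Type*} [Ring R] [Ring R'] [DivisionRing E]
    [DivisionRing E'] (ι : R →+* E) (ι' : R' →+* E') (φ : E →+* E')
    (hφ : ∀ r, φ (ι r) ∈ ι'.range) (n : ℕ) {a : E} (ha : a ∈ stage ι n) :
    φ a ∈ stage ι' n := by
  induction n generalizing a with
  | zero =>
    obtain ⟨r, rfl⟩ := ha
    exact hφ r
  | succ n ih =>
    have hle : stage ι (n + 1) ≤ (stage ι' (n + 1)).comap φ := by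
      refine Subring.closure_le.mpr ?_
      rintro t (ht | ⟨s, hs, hs0, rfl⟩)
      · exact Subring.subset_closure (Or.inl (ih ht))
      · exact Subring.subset_closure
          (Or.inr ⟨φ s, ih hs, (map_ne_zero φ).mpr hs0, map_inv₀ φ s⟩)
    exact hle ha

theorem stage_le_succ {R E : Type*} [Ring R] [DivisionRing E] (ι : R →+* E) (n : ℕ) :
    stage ι n ≤ stage ι (n + 1) :=
  fun _ hr => Subring.subset_closure (Or.inl hr)

theorem inv_mem_stage_succ {R E : Type*} [Ring R] [DivisionRing E] (ι : R →+* E) {n : ℕ} {s : E}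
    (hs : s ∈ stage ι n) : s⁻¹ ∈ stage ι (n + 1) := by
  by_cases h0 : s = 0
  · rw [h0, inv_zero]
    exact zero_mem _
  · exact Subring.subset_closure (Or.inr ⟨s, hs, h0, rfl⟩)

namespace Series

variable {F G : Type*} [DivisionRing F] [Group G] [LinearOrder G] [MulLeftMono G]
  [MulRightMono G] {d : CrossedSystem F G}

theorem exists_isLeast_supp {f : Series d} (hf : f ≠ 0) : ∃ x₀, IsLeast f.supp x₀ := by
  have hne : f.supp.Nonempty := by
    by_contra h
    refine hf (Series.ext fun x => ?_)
    by_contra hx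
    exact h ⟨x, hx⟩
  exact ⟨_, f.isPWO_supp.isWF.min_mem hne, fun x hx => f.isPWO_supp.isWF.min_le hne hx⟩

/-- A subring that is stable under the crossed product structure and contains the coefficients of a
nonzero series together with the inverse of its lowest coefficient contains the coefficients of the
inverse series. -/
theorem coeff_inv_mem (A : Subring F) (hact : ∀ x, ∀ a ∈ A, d.act x a ∈ A)
    (hsymm : ∀ x, ∀ a ∈ A, (d.act x).symm a ∈ A) (htwist : ∀ x y, (d.twist x y : F) ∈ A)
    (hinv : ∀ x y, (((d.twist x y)⁻¹ : Fˣ) : F) ∈ A) {f : Series d} {x₀ : G}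
    (hx₀ : IsLeast f.supp x₀) (hf : ∀ x, f.coeff x ∈ A) (hf₀ : (f.coeff x₀)⁻¹ ∈ A) (x : G) :
    (f⁻¹).coeff x ∈ A := by
  have h0 : f.coeff x₀ ≠ 0 := hx₀.1
  have hfne : f ≠ 0 := by
    rintro rfl
    exact h0 rfl
  by_contra hx
  -- a minimal counterexample exists, as counterexamples lie in the well-ordered support of `f⁻¹`
  have hB : {x | (f⁻¹).coeff x ∉ A}.IsWF := (f⁻¹).isPWO_supp.isWF.mono fun y hy hy0 =>
    hy (by rw [hy0]; exact zero_mem A)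
  obtain ⟨z, hz, hmin⟩ : ∃ z, (f⁻¹).coeff z ∉ A ∧ ∀ y < z, (f⁻¹).coeff y ∈ A :=
    ⟨hB.min ⟨x, hx⟩, hB.min_mem ⟨x, hx⟩, fun y hy => by
      by_contra hyA
      exact hB.not_lt_min ⟨x, hx⟩ hyA hy⟩
  apply hz
  have hfin : (Function.support (mulTerm f f⁻¹ (x₀ * z))).Finite := mulTerm_finite f f⁻¹ (x₀ * z)
  have hx₀_mem : x₀ ∈ insert x₀ hfin.toFinset := Finset.mem_insert_self _ _
  have hsum : mulTerm f f⁻¹ (x₀ * z) x₀ +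
      ∑ y ∈ (insert x₀ hfin.toFinset).erase x₀, mulTerm f f⁻¹ (x₀ * z) y =
        (1 : Series d).coeff (x₀ * z) := by
    rw [Finset.add_sum_erase _ _ hx₀_mem, ← mul_inv_cancel₀ hfne, coeff_mul]
    refine (finsum_eq_sum_of_support_subset _ fun y hy => ?_).symm
    exact Finset.mem_insert_of_mem (hfin.mem_toFinset.mpr hy)
  have hrest : ∑ y ∈ (insert x₀ hfin.toFinset).erase x₀, mulTerm f f⁻¹ (x₀ * z) y ∈ A := by
    refine Subring.sum_mem A fun y hy => ?_
    obtain ⟨hne, hy⟩ := Finset.mem_erase.mp hy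
    have hy := mulTerm_ne (hfin.mem_toFinset.mp (Finset.mem_of_mem_insert_of_ne hy hne))
    have hlt : x₀ < y := lt_of_le_of_ne (hx₀.2 hy.1) hne.symm
    have hyz : y⁻¹ * (x₀ * z) < z := by
      rw [← mul_assoc]
      exact mul_lt_of_lt_one_left' z (inv_mul_lt_one_iff.mpr hlt)
    exact mul_mem (mul_mem (hf y) (hact y _ (hmin _ hyz))) (htwist _ _)
  have hone : (1 : Series d).coeff (x₀ * z) ∈ A := by
    rw [one_def, coeff_single]
    split
    · exact one_mem A
    · exact zero_mem A
  have hlead : mulTerm f f⁻¹ (x₀ * z) x₀ ∈ A := by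
    rw [eq_sub_of_add_eq hsum]
    exact sub_mem hone hrest
  have hsolve : (f⁻¹).coeff z = (d.act x₀).symm ((f.coeff x₀)⁻¹ *
      (mulTerm f f⁻¹ (x₀ * z) x₀ * ((d.twist x₀ z)⁻¹ : Fˣ))) := by
    rw [mulTerm, inv_mul_cancel_left, Units.mul_inv_cancel_right, inv_mul_cancel_left₀ h0,
      RingEquiv.symm_apply_apply]
  rw [hsolve]
  exact hsymm _ _ (mul_mem hf₀ (mul_mem hlead (hinv _ _)))

end Series

namespace IsExtension

variable {S F G : Type*} [Ring S] [DivisionRing F] [Group G] [LinearOrder G] [MulLeftMono G]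
  [MulRightMono G] {ε : S →+* F} {c : CrossedSystem S G} {d : CrossedSystem F G}

theorem mem_stageSeries_iff (h : IsExtension ε c d) {n : ℕ} {f : Series d} :
    f ∈ h.stageSeries n ↔ ∀ x, f.coeff x ∈ stage ε n := by
  constructor
  · rintro ⟨g, rfl⟩ x
    exact (g.coeff x).2
  · intro hf
    refine ⟨Series.mk (h.stageSystem n) (fun x => ⟨f.coeff x, hf x⟩)
      (f.isPWO_supp.mono fun x hx h0 => hx (Subtype.ext h0)), ?_⟩
    exact Series.ext fun x => rfl

theorem inv_mem_stageSeries_succ (h : IsExtension ε c d) {n : ℕ} {f : Series d}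
    (hf : f ∈ h.stageSeries n) (hf0 : f ≠ 0) : f⁻¹ ∈ h.stageSeries (n + 1) := by
  rw [mem_stageSeries_iff] at hf ⊢
  obtain ⟨x₀, hx₀⟩ := Series.exists_isLeast_supp hf0
  -- the stability of `F_ε(n + 1)` is part of the crossed product `F_ε(n + 1)G`
  exact Series.coeff_inv_mem (stage ε (n + 1))
    (fun x a ha => ((h.stageSystem (n + 1)).act x ⟨a, ha⟩).2)
    (fun x a ha => (((h.stageSystem (n + 1)).act x).symm ⟨a, ha⟩).2)
    (fun x y => ((h.stageSystem (n + 1)).twist x y : stage ε (n + 1)).2)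
    (fun x y => (((h.stageSystem (n + 1)).twist x y)⁻¹ : (stage ε (n + 1))ˣ).val.2)
    hx₀ (fun x => stage_le_succ ε n (hf x)) (inv_mem_stage_succ ε (hf x₀))

theorem stage_embedding_le_stageSeries (h : IsExtension ε c d) (n : ℕ) :
    stage h.embedding n ≤ h.stageSeries n := by
  induction n with
  | zero =>
    rintro _ ⟨g, rfl⟩
    exact h.mem_stageSeries_iff.mpr fun x => ⟨g.coeff x, rfl⟩
  | succ n ih =>
    refine Subring.closure_le.mpr ?_
    rintro t (ht | ⟨s, hs, hs0, rfl⟩)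
    · exact h.mem_stageSeries_iff.mpr fun x =>
        stage_le_succ ε n (h.mem_stageSeries_iff.mp (ih ht) x)
    · exact h.inv_mem_stageSeries_succ (ih hs) hs0

theorem C_mem_stage (h : IsExtension ε c d) {n : ℕ} {a : F} (ha : a ∈ stage ε n) :
    Series.C d a ∈ stage h.embedding n := by
  refine map_mem_stage_of_range ε h.embedding (Series.C d) (fun r => ?_) n ha
  refine ⟨CrossedProduct.single c 1 r, Series.ext fun x => ?_⟩
  change ε (Finsupp.single 1 r x) = (Series.single d 1 (ε r)).coeff x
  classical
  rw [Series.coeff_single, Finsupp.single_apply, apply_ite ε, map_zero]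
  exact if_congr eq_comm rfl rfl

theorem C_mem_stage_iff (h : IsExtension ε c d) {n : ℕ} {a : F} :
    Series.C d a ∈ stage h.embedding n ↔ a ∈ stage ε n := by
  refine ⟨fun ha => ?_, h.C_mem_stage⟩
  have h1 := h.mem_stageSeries_iff.mp (h.stage_embedding_le_stageSeries n ha) 1
  have h2 : (Series.C d a).coeff 1 = a := (Series.coeff_single 1 1 a).trans (if_pos rfl)
  rwa [h2] at h1

theorem hasHeight_C (h : IsExtension ε c d) {f : F} {n : ℕ} (hf : HasHeight ε f n) :
    HasHeight h.embedding (Series.C d f) n := by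
  cases n with
  | zero => exact h.C_mem_stage_iff.mpr hf
  | succ n => exact ⟨h.C_mem_stage_iff.mpr hf.1, fun h' => hf.2 (h.C_mem_stage_iff.mp h')⟩

theorem height_le_height_embedding (h : IsExtension ε c d) :
    height ε ≤ height h.embedding := by
  refine sInf_le_sInf ?_
  rintro _ ⟨n, rfl, hn⟩
  refine ⟨n, rfl, fun s hs hs0 => ?_⟩
  rw [← h.C_mem_stage_iff, map_inv₀]
  exact hn _ (h.C_mem_stage hs) ((map_ne_zero _).mpr hs0)

end IsExtension

end InversionHeight

theorem mainTheorem11 {S F G : Type*} [Ring S] [IsDomain S] [DivisionRing F]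
    [Group G] [LinearOrder G] [MulLeftMono G] [MulRightMono G]
    (ε : S →+* F) (hε : InversionHeight.IsFieldOfFractions ε)
    (c : InversionHeight.CrossedSystem S G) (d : InversionHeight.CrossedSystem F G)
    (h : InversionHeight.IsExtension ε c d) :
    (∀ n : ℕ, InversionHeight.stage h.embedding n ≤ h.stageSeries n) ∧
    (∀ (f : F) (n : ℕ), InversionHeight.HasHeight ε f n →
      InversionHeight.HasHeight h.embedding (InversionHeight.Series.C d f) n) ∧
    InversionHeight.height ε ≤ InversionHeight.height h.embedding :=
  ⟨h.stage_embedding_le_stageSeries, fun _ _ => h.hasHeight_C, h.height_le_height_embedding⟩
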